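/- For a sequence $M_0\xrightarrow{f_0}M_1\xrightarrow{f_1}M_2\to\cdots$ of posets and monotone maps, let $\Sigma_nM_n$ (the lax sum of $M_0\to\cdots\to M_n$) be the disjoint union of $M_0,\dots,M_n$, with elements written $(x,j)$ for $x\in M_j$, $j\le n$, ordered by $$(x,j)\le(y,k)\iff j\le k\ \text{ and }\ (f_{k-1}\circ\cdots\circ f_j)(x)\le y .$$ The maps $(x,j)\mapsto(x,j)$ make $\Sigma_0M_0\to\Sigma_1M_1\to\Sigma_2M_2\to\cdots$ again a sequence of posets and monotone maps; iterating this construction $k$ times gives the sequence of posets $\Sigma^k_nM_n$, $n\ge 0$ (with $\Sigma^0_nM_n=M_n$). Let $C_n$ be the chain with $n+1$ elements, and let $\Sigma^k_nC_0$ be the result of this for the constant sequence $C_0\to C_0\to\cdots$ of identity maps of the one-element chain. **Theorem.** Let $k,n\ge 0$. The poset $\Sigma^k_nC_0$ is isomorphic to the subposet of the cartesian power $C_n^k$ consisting of the points $(x_1,\dots,x_k)$ with $x_1\le x_2\le\cdots\le x_k$ (and likewise to the subposet of the points with $x_1\ge x_2\ge\cdots\ge x_k$). It has finitely many maximal chains,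 and their number is the $k$-dimensional Catalan number $$\#\Sigma^k_nC_0=\frac{0!\,1!\,2!\cdots(k-1)!\;(kn)!}{n!\,(n+1)!\cdots(n+k-1)!},$$ where empty products are $1$. -/

import Mathlib

open scoped Nat

universe u

/-- A sequence `M₀ → M₁ → M₂ → ⋯` of posets and monotone maps. -/
structure PosetSeq where
  /-- the posets of the sequence -/
  obj : ℕ → Type u
  [instPartialOrder : ∀ n, PartialOrder (obj n)]
  /-- the monotone maps `f n : M n → M (n + 1)` -/
  map : ∀ n, obj n →o obj (n + 1)

namespace PosetSeq

instance (M : PosetSeq.{u}) (n : ℕ) : PartialOrder (M.obj n) := M.instPartialOrder n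

/-- The composite `f (k - 1) ∘ ⋯ ∘ f j : M j → M k`, for `j ≤ k` (the identity if `j = k`). -/
def transition (M : PosetSeq.{u}) {j k : ℕ} (h : j ≤ k) (x : M.obj j) : M.obj k :=
  Nat.leRecOn h (fun {i} => M.map i) x

theorem transition_self (M : PosetSeq.{u}) {j : ℕ} (h : j ≤ j) (x : M.obj j) :
    M.transition h x = x :=
  Nat.leRecOn_self x

theorem transition_succ (M : PosetSeq.{u}) {j k : ℕ} (h : j ≤ k) (h' : j ≤ k + 1)
    (x : M.obj j) : M.transition h' x = M.map k (M.transition h x) :=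
  Nat.leRecOn_succ h x

theorem transition_transition (M : PosetSeq.{u}) {i j k : ℕ} (hij : i ≤ j) (hjk : j ≤ k)
    (x : M.obj i) :
    M.transition hjk (M.transition hij x) = M.transition (hij.trans hjk) x :=
  (Nat.leRecOn_trans hij hjk x).symm

theorem transition_mono (M : PosetSeq.{u}) {j k : ℕ} (h : j ≤ k) {x y : M.obj j}
    (hxy : x ≤ y) : M.transition h x ≤ M.transition h y := by
  induction k, h using Nat.le_induction with
  | base => simpa only [transition_self] using hxy
  | succ k h ih =>
    rw [M.transition_succ h, M.transition_succ h]
    exact (M.map k).monotone ih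

/-- The underlying set of the lax sum `Σₙ Mₙ` of `M₀ → ⋯ → Mₙ`: the disjoint union of
`M₀, …, Mₙ`.  Its elements are the pairs `(x, j)` with `j ≤ n` and `x ∈ M j`. -/
@[ext]
structure LaxSum (M : PosetSeq.{u}) (n : ℕ) : Type u where
  /-- the index `j` of the summand -/
  idx : ℕ
  idx_le : idx ≤ n
  /-- the element `x` of `M j` -/
  val : M.obj idx

/-- The order of the lax sum: `(x, j) ≤ (y, k)` if and only if `j ≤ k` and
`(f (k - 1) ∘ ⋯ ∘ f j) x ≤ y`. -/
instance (M : PosetSeq.{u}) (n : ℕ) : PartialOrder (M.LaxSum n) where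
  le a b := ∃ h : a.idx ≤ b.idx, M.transition h a.val ≤ b.val
  le_refl a := ⟨le_rfl, (M.transition_self _ _).le⟩
  le_trans := by
    rintro a b c ⟨hab, h⟩ ⟨hbc, h'⟩
    refine ⟨hab.trans hbc, ?_⟩
    rw [← M.transition_transition hab hbc]
    exact (M.transition_mono hbc h).trans h'
  le_antisymm := by
    rintro ⟨i, hi, x⟩ ⟨j, hj, y⟩ ⟨hij, h⟩ ⟨hji, h'⟩
    obtain rfl : i = j := le_antisymm hij hji
    rw [M.transition_self] at h h'
    obtain rfl : x = y := le_antisymm h h'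
    rfl

/-- The sequence of lax sums `Σ₀ M₀ → Σ₁ M₁ → Σ₂ M₂ → ⋯`, with the maps `(x, j) ↦ (x, j)`. -/
def stack (M : PosetSeq.{u}) : PosetSeq.{u} where
  obj n := M.LaxSum n
  map n :=
    { toFun := fun a => ⟨a.idx, a.idx_le.trans n.le_succ, a.val⟩
      monotone' := fun _ _ h => h }

/-- The `k`-fold iteration of stacking; its `n`-th term is `Σᵏₙ Mₙ`. -/
def iterStack (M : PosetSeq.{u}) : ℕ → PosetSeq.{u}
  | 0 => M
  | k + 1 => (M.iterStack k).stack

end PosetSeq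

/-- The chain `Cₙ` with `n + 1` elements. -/
abbrev ChainPoset (n : ℕ) : Type := Fin (n + 1)

/-- The constant sequence `C₀ → C₀ → C₀ → ⋯` of identity maps of the one-element chain. -/
def trivialSeq : PosetSeq.{0} where
  obj _ := ChainPoset 0
  map _ := OrderHom.id

/-- The poset `Σᵏₙ C₀`. -/
abbrev StackedTrivial (k n : ℕ) : Type := (trivialSeq.iterStack k).obj n

/-- The number of maximal chains of a poset (it is `0` if there are infinitely many). -/
noncomputable def numMaxChains (P : Type*) [PartialOrder P] : ℕ :=
  {s : Set P | IsMaxChain (· ≤ ·) s}.ncard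

/-! Recording the summand index at each level of stacking turns `Σᵏₙ C₀` into the weakly increasing
vectors of length `k` bounded by `n`, ordered componentwise (`coords_le_coords`, `range_coords`).
This is the principal ideal below `(n, …, n)` in a Young lattice, so its maximal chains correspond
to standard tableaux of a rectangle.

They are counted by Frobenius' formula `N(x) · ∏ lᵢ! = |x|! · Δ(l)`, where `lᵢ = xᵢ + i` and `Δ` is
the Vandermonde determinant. It follows by induction on `|x| = ∑ xᵢ`: `N(x)` is the sum of `N` over
the lower covers of `x` (`ncard_maxChainsBelow`), and `Δ` satisfies the matching recursion `∑ lᵢ Δ(l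
- eᵢ) = |x| Δ(l)` (`sum_mul_descFactorialDet_update`). At `lᵢ = n + i` the determinant is `∏ i!`. -/

/-! ### Determinants of falling factorials -/

/-- Multiplying the columns of a matrix by scalars `d`, one row at a time, and adding up the
determinants multiplies the determinant by `∑ d`. -/
theorem Matrix.sum_det_updateRow_mul {ι R : Type*} [Fintype ι] [DecidableEq ι] [CommRing R]
    (A : Matrix ι ι R) (d : ι → R) :
    ∑ i, (A.updateRow i fun j => A i j * d j).det = (∑ j, d j) * A.det := by
  -- Expand along the replaced row; summing over `i` then produces the diagonal entries of `adjugate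
  -- A * A`.
  have h (i : ι) : (A.updateRow i fun j => A i j * d j).det
      = ∑ j, d j * (A.adjugate j i * A i j) := by
    rw [← Matrix.cramer_transpose_apply, Matrix.cramer_eq_adjugate_mulVec,
      ← Matrix.adjugate_transpose, Matrix.mulVec, dotProduct]
    exact Finset.sum_congr rfl fun j _ => by rw [Matrix.transpose_apply]; ring
  simp_rw [h]
  rw [Finset.sum_comm, Finset.sum_mul]
  refine Finset.sum_congr rfl fun j _ => ?_
  rw [← Finset.mul_sum, ← Matrix.mul_apply, Matrix.adjugate_mul]
  simp

/-- The Vandermonde determinant of natural numbers, in the basis of falling factorials. -/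
def descFactorialDet {k : ℕ} (l : Fin k → ℕ) : ℤ :=
  (Matrix.of fun i j : Fin k => ((l i).descFactorial j : ℤ)).det

theorem descFactorialDet_eq_vandermonde {k : ℕ} (l : Fin k → ℕ) :
    descFactorialDet l = (Matrix.vandermonde fun i => (l i : ℤ)).det := by
  rw [Matrix.det_eval_matrixOfPolynomials_eq_det_vandermonde (fun i => (l i : ℤ))
    (fun j => descPochhammer ℤ j) (fun j => descPochhammer_natDegree ℤ j)
    (fun j => monic_descPochhammer ℤ j)]
  simp only [descPochhammer_eval_eq_descFactorial, descFactorialDet]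

/-- The Vandermonde determinant is translation invariant, and at `n = 0` the falling factorial
matrix is lower triangular with diagonal `i!`. -/
theorem descFactorialDet_add_val {k : ℕ} (n : ℕ) :
    descFactorialDet (fun i : Fin k => n + i) = ∏ i ∈ Finset.range k, (i ! : ℤ) := by
  have h : descFactorialDet (fun i : Fin k => n + i)
      = descFactorialDet (fun i : Fin k => (i : ℕ)) := by
    simp only [descFactorialDet_eq_vandermonde]
    rw [← Matrix.det_vandermonde_add (fun i : Fin k => ((i : ℕ) : ℤ)) (n : ℤ)]
    simp only [Nat.cast_add, add_comm]
  rw [h, descFactorialDet, Matrix.det_of_isLowerTriangular]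
  · simp [Nat.descFactorial_self, Fin.prod_univ_eq_prod_range (fun i => (i ! : ℤ))]
  · intro i j hij
    simpa [Nat.descFactorial_eq_zero_iff_lt] using hij

theorem descFactorialDet_eq_zero {k : ℕ} {l : Fin k → ℕ} {i j : Fin k} (hij : i ≠ j)
    (h : l i = l j) : descFactorialDet l = 0 :=
  Matrix.det_zero_of_row_eq hij (by ext; simp [h])

theorem Nat.mul_descFactorial_pred (m j : ℕ) :
    (m : ℤ) * ((m - 1).descFactorial j : ℤ) = (m.descFactorial j : ℤ) * (m - j) := by
  rcases m with _ | m
  · rcases j with _ | j <;> simp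
  · rw [Nat.add_sub_cancel, ← Nat.cast_mul, ← Nat.succ_descFactorial_succ,
      Nat.descFactorial_succ]
    rcases le_or_gt j (m + 1) with h | h
    · push_cast [h]; ring
    · rw [Nat.descFactorial_of_lt h]; simp

/-- Multiplying the lowered row by `lᵢ` gives `lᵢ` times the old row minus the old row with column
`j` scaled by `j`. The scaled rows contribute `-∑ j` times the determinant in total. -/
theorem sum_mul_descFactorialDet_update {k : ℕ} (l : Fin k → ℕ) :
    ∑ i, (l i : ℤ) * descFactorialDet (Function.update l i (l i - 1))
      = (∑ i, ((l i : ℤ) - (i : ℕ))) * descFactorialDet l := by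
  set A : Matrix (Fin k) (Fin k) ℤ := Matrix.of fun i j => ((l i).descFactorial j : ℤ) with hA
  have h (i : Fin k) : (l i : ℤ) * descFactorialDet (Function.update l i (l i - 1))
      = l i * A.det + (A.updateRow i fun j => A i j * -((j : ℕ) : ℤ)).det := by
    have h1 : (Matrix.of fun a j : Fin k =>
        ((Function.update l i (l i - 1) a).descFactorial j : ℤ))
        = A.updateRow i fun j => ((l i - 1).descFactorial j : ℤ) := by
      ext a j
      rcases eq_or_ne a i with rfl | ha <;> simp [*]
    have h2 : ((l i : ℤ) • fun j : Fin k => ((l i - 1).descFactorial j : ℤ))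
        = (l i : ℤ) • A i + fun j => A i j * -((j : ℕ) : ℤ) := by
      ext j
      simp only [Pi.smul_apply, smul_eq_mul, Nat.mul_descFactorial_pred, Pi.add_apply, hA,
        Matrix.of_apply]
      ring
    rw [descFactorialDet, h1, ← Matrix.det_updateRow_smul, h2, Matrix.det_updateRow_add,
      Matrix.det_updateRow_smul, Matrix.updateRow_eq_self]
  simp_rw [h]
  rw [Finset.sum_add_distrib, Matrix.sum_det_updateRow_mul, ← Finset.sum_mul, ← add_mul,
    ← Finset.sum_add_distrib]
  rfl

/-! ### Recursion for maximal chains over lower covers -/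

section MaxChainsBelow
variable {Q : Type*} [PartialOrder Q]

/-- The maximal chains of the principal ideal below `x`, as subsets of the ambient poset. -/
def maxChainsBelow (x : Q) : Set (Set Q) :=
  {s | IsChain (· ≤ ·) s ∧ s ⊆ Set.Iic x ∧
    ∀ t, IsChain (· ≤ ·) t → t ⊆ Set.Iic x → s ⊆ t → s = t}

theorem mem_of_mem_maxChainsBelow {x : Q} {s : Set Q} (hs : s ∈ maxChainsBelow x) : x ∈ s := by
  have h := hs.2.2 (insert x s) (hs.1.insert fun b hb _ => Or.inr (hs.2.1 hb))
    (Set.insert_subset le_rfl hs.2.1) (Set.subset_insert _ _)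
  rw [h]
  exact Set.mem_insert _ _

theorem notMem_of_mem_maxChainsBelow {x y : Q} (hyx : y < x) {s : Set Q}
    (hs : s ∈ maxChainsBelow y) : x ∉ s :=
  fun h => (hs.2.1 h).not_gt hyx

theorem maxChainsBelow_of_isMin {x : Q} (hx : IsMin x) : maxChainsBelow x = {{x}} := by
  have hI : Set.Iic x = {x} := hx.Iic_eq
  ext s
  constructor
  · intro hs
    exact Set.Subset.antisymm (hI ▸ hs.2.1)
      (Set.singleton_subset_iff.2 (mem_of_mem_maxChainsBelow hs))
  · rintro rfl
    exact ⟨Set.subsingleton_singleton.isChain, hI.ge, fun t _ ht hst =>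
      Set.Subset.antisymm hst (hI ▸ ht)⟩

theorem insert_mem_maxChainsBelow {x y : Q} (hyx : y ⋖ x) {t : Set Q}
    (ht : t ∈ maxChainsBelow y) : insert x t ∈ maxChainsBelow x := by
  have htx : t ⊆ Set.Iic x := fun z hz => (ht.2.1 hz).trans hyx.le
  refine ⟨ht.1.insert fun b hb _ => Or.inr (htx hb), Set.insert_subset le_rfl htx, ?_⟩
  intro u hu hux htu
  have hxu : x ∈ u := htu (Set.mem_insert _ _)
  have h : t = u \ {x} := by
    refine ht.2.2 _ (hu.mono Set.sdiff_subset) ?_ ?_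
    · rintro z ⟨hz, hzx⟩
      have hzx' : z < x := lt_of_le_of_ne (hux hz) hzx
      rcases hu.total hz (htu (Set.mem_insert_of_mem _ (mem_of_mem_maxChainsBelow ht)))
        with h | h
      · exact h
      · exact (h.eq_or_lt.resolve_right fun h' => hyx.2 h' hzx').ge
    · exact fun z hz => ⟨htu (Set.mem_insert_of_mem _ hz), by
        rintro rfl; exact notMem_of_mem_maxChainsBelow hyx.lt ht hz⟩
  rw [h, Set.insert_sdiff_singleton, Set.insert_eq_of_mem hxu]

/-- Remove `x`: what remains is a finite nonempty chain, and its top `y` is covered by `x`, since an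
element strictly between could be added to `s`. -/
theorem exists_covBy_of_mem_maxChainsBelow {x : Q} (hfin : (Set.Iic x).Finite) (hx : ¬ IsMin x)
    {s : Set Q} (hs : s ∈ maxChainsBelow x) :
    ∃ y, y ⋖ x ∧ ∃ t ∈ maxChainsBelow y, insert x t = s := by
  have hxs := mem_of_mem_maxChainsBelow hs
  have hne : (s \ {x}).Nonempty := by
    obtain ⟨w, hw⟩ := not_isMin_iff.1 hx
    by_contra h
    rw [Set.not_nonempty_iff_eq_empty, Set.sdiff_eq_empty] at h
    have h1 := hs.2.2 {w, x} (by
        refine Set.subsingleton_singleton.isChain.insert fun b hb _ => Or.inl ?_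
        rw [Set.mem_singleton_iff.1 hb]; exact hw.le)
      (Set.insert_subset hw.le (Set.singleton_subset_iff.2 le_rfl))
      (h.trans (Set.subset_insert _ _))
    have h2 : w ∈ s := h1 ▸ Set.mem_insert _ _
    exact hw.ne (h h2)
  have hts : s \ {x} ⊆ s := Set.sdiff_subset
  obtain ⟨y, hy⟩ := (hfin.subset (hts.trans hs.2.1)).exists_maximal hne
  have hyx : y < x := lt_of_le_of_ne (hs.2.1 hy.1.1) hy.1.2
  have hty : s \ {x} ⊆ Set.Iic y := fun z hz =>
    (hs.1.total hz.1 hy.1.1).elim id fun h => hy.2 hz h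
  have hins : insert x (s \ {x}) = s := by
    rw [Set.insert_sdiff_singleton, Set.insert_eq_of_mem hxs]
  refine ⟨y, ⟨hyx, ?_⟩, s \ {x}, ⟨hs.1.mono hts, hty, ?_⟩, hins⟩
  · intro z hyz hzx
    have h := hs.2.2 (insert z s) (hs.1.insert fun b hb _ => ?_)
      (Set.insert_subset hzx.le hs.2.1) (Set.subset_insert _ _)
    · have hzs : z ∈ s := h ▸ Set.mem_insert _ _
      exact (hty ⟨hzs, hzx.ne⟩ : z ≤ y).not_gt hyz
    · rcases eq_or_ne b x with rfl | hbx
      · exact Or.inl hzx.le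
      · exact Or.inr ((hty ⟨hb, hbx⟩ : b ≤ y).trans hyz.le)
  · intro u hu huy hsu
    have hux : u ⊆ Set.Iic x := fun z hz => (huy hz).trans hyx.le
    have h := hs.2.2 (insert x u) (hu.insert fun b hb _ => Or.inr (hux hb))
      (Set.insert_subset le_rfl hux) (by rw [← hins]; exact Set.insert_subset_insert hsu)
    refine Set.Subset.antisymm hsu fun z hz => ⟨?_, fun hzx => ?_⟩
    · rw [h]; exact Set.mem_insert_of_mem _ hz
    · rw [Set.mem_singleton_iff.1 hzx] at hz
      exact (huy hz).not_gt hyx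

theorem maxChainsBelow_eq_biUnion {x : Q} (hfin : (Set.Iic x).Finite) (hx : ¬ IsMin x) :
    maxChainsBelow x = ⋃ y ∈ {y | y ⋖ x}, insert x '' maxChainsBelow y := by
  ext s
  simp only [Set.mem_ofPred_eq, Set.mem_iUnion, Set.mem_image, exists_prop]
  constructor
  · exact exists_covBy_of_mem_maxChainsBelow hfin hx
  · rintro ⟨y, hyx, t, ht, rfl⟩
    exact insert_mem_maxChainsBelow hyx ht

theorem finite_maxChainsBelow {x : Q} (hfin : (Set.Iic x).Finite) : (maxChainsBelow x).Finite :=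
  hfin.finite_subsets.subset fun _ hs => hs.2.1

theorem injOn_insert_maxChainsBelow {x y : Q} (hyx : y < x) :
    Set.InjOn (insert x) (maxChainsBelow y) := by
  intro s hs t ht h
  rw [← Set.insert_sdiff_self_of_notMem (notMem_of_mem_maxChainsBelow hyx hs), h,
    Set.insert_sdiff_self_of_notMem (notMem_of_mem_maxChainsBelow hyx ht)]

theorem ncard_maxChainsBelow {x : Q} (hfin : (Set.Iic x).Finite) (hx : ¬ IsMin x) :
    (maxChainsBelow x).ncard = ∑ᶠ y ∈ {y | y ⋖ x}, (maxChainsBelow y).ncard := by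
  have hlt : ∀ y ∈ {y | y ⋖ x}, y < x := fun y hy => CovBy.lt hy
  have hfin' : ∀ y ∈ {y | y ⋖ x}, (maxChainsBelow y).Finite := fun y hy =>
    finite_maxChainsBelow (hfin.subset (Set.Iic_subset_Iic.2 (hlt y hy).le))
  rw [maxChainsBelow_eq_biUnion hfin hx, Set.Finite.ncard_biUnion]
  · exact finsum_mem_congr rfl fun y hy =>
      (injOn_insert_maxChainsBelow (hlt y hy)).ncard_image
  · exact hfin.subset fun y hy => (hlt y hy).le
  · exact fun y hy => (hfin' y hy).image _
  -- The inserted `x` can be removed again, and `y` is recovered as the greatest element of the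
  -- remaining chain.
  · intro y hy z hz hyz
    refine Set.disjoint_left.2 ?_
    rintro _ ⟨s, hs, rfl⟩ ⟨t, ht, h⟩
    have hst : s = t := by
      rw [← Set.insert_sdiff_self_of_notMem (notMem_of_mem_maxChainsBelow (hlt y hy) hs), ← h,
        Set.insert_sdiff_self_of_notMem (notMem_of_mem_maxChainsBelow (hlt z hz) ht)]
    subst hst
    exact hyz (le_antisymm (ht.2.1 (mem_of_mem_maxChainsBelow hs))
      (hs.2.1 (mem_of_mem_maxChainsBelow ht)))

theorem image_setOf_isMaxChain {P : Type*} [PartialOrder P] (f : P ↪o Q) {x : Q}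
    (hf : Set.range f = Set.Iic x) :
    (f '' ·) '' {s : Set P | IsMaxChain (· ≤ ·) s} = maxChainsBelow x := by
  have hsub (s : Set P) : f '' s ⊆ Set.Iic x := hf ▸ Set.image_subset_range f s
  have hchain (s : Set P) : IsChain (· ≤ ·) (f '' s) ↔ IsChain (· ≤ ·) s :=
    ⟨fun h => by
      have := IsChain.preimage (· ≤ ·) (· ≤ ·) f f.injective (fun _ _ => f.le_iff_le.1) h
      rwa [Set.preimage_image_eq _ f.injective] at this,
      fun h => by
      rintro _ ⟨a, ha, rfl⟩ _ ⟨b, hb, rfl⟩ _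
      exact (h.total ha hb).imp f.le_iff_le.2 f.le_iff_le.2⟩
  ext s
  constructor
  · rintro ⟨s, hs, rfl⟩
    refine ⟨(hchain s).2 hs.1, hsub s, fun t ht htx hst => ?_⟩
    obtain ⟨t, rfl⟩ := Set.subset_range_iff_exists_image_eq.1 (hf ▸ htx)
    exact congrArg _ (hs.2 ((hchain t).1 ht) ((Set.image_subset_image_iff f.injective).1 hst))
  · rintro ⟨hs, hsx, hmax⟩
    obtain ⟨s, rfl⟩ := Set.subset_range_iff_exists_image_eq.1 (hf ▸ hsx)
    exact ⟨s, ⟨(hchain s).1 hs, fun t ht hst =>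
      f.injective.image_injective (hmax _ ((hchain t).2 ht) (hsub t) (Set.image_mono hst))⟩, rfl⟩

theorem numMaxChains_eq_ncard_maxChainsBelow {P : Type*} [PartialOrder P] (f : P ↪o Q) {x : Q}
    (hf : Set.range f = Set.Iic x) : numMaxChains P = (maxChainsBelow x).ncard := by
  rw [← image_setOf_isMaxChain f hf, numMaxChains]
  exact (Set.ncard_image_of_injective _ f.injective.image_injective).symm

end MaxChainsBelow

/-! ### Weakly increasing vectors and Frobenius' formula -/

/-- The poset of weakly increasing vectors of natural numbers of length `k`. -/
abbrev MonotoneVec (k : ℕ) : Type := {x : Fin k → ℕ // Monotone x}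

namespace MonotoneVec
variable {k : ℕ}

/-- The indices of the coordinates which can be lowered by one. -/
def IsRemovable (x : MonotoneVec k) (i : Fin k) : Prop :=
  0 < x.1 i ∧ Monotone (Function.update x.1 i (x.1 i - 1))

/-- Lower a coordinate by one. -/
def lower (x : MonotoneVec k) (i : {i // x.IsRemovable i}) : MonotoneVec k :=
  ⟨Function.update x.1 i (x.1 i - 1), i.2.2⟩

theorem lower_covBy (x : MonotoneVec k) (i : {i // x.IsRemovable i}) : x.lower i ⋖ x := by
  obtain ⟨i, h0, hi⟩ := i
  refine ⟨?_, ?_⟩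
  · refine Subtype.coe_lt_coe.1 (?_ : Function.update x.1 i (x.1 i - 1) < x.1)
    rw [update_lt_self_iff]
    omega
  · intro z hz hzx
    have h1 : Function.update x.1 i (x.1 i - 1) ≤ z.1 := hz.le
    have h2 : z.1 ≤ x.1 := hzx.le
    rw [update_le_iff] at h1
    have hne (j : Fin k) (hj : j ≠ i) : z.1 j = x.1 j := le_antisymm (h2 j) (h1.2 j hj)
    rcases (show z.1 i = x.1 i ∨ z.1 i = x.1 i - 1 by
        have h3 : z.1 i ≤ x.1 i := h2 i
        have := h1.1
        omega)
      with h | h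
    · refine hzx.ne (Subtype.ext (funext fun j => ?_))
      rcases eq_or_ne j i with rfl | hj
      exacts [h, hne j hj]
    · refine hz.ne' (Subtype.ext (funext fun j => ?_))
      rcases eq_or_ne j i with rfl | hj
      · simpa [lower] using h
      · simpa [lower, hj] using hne j hj

/-- Lower `x` at the least `i` with `y i < x i`: for `j < i`, `x j = y j ≤ y i < x i`, so the result
is still increasing. -/
theorem exists_lower_of_lt {x y : MonotoneVec k} (h : y < x) : ∃ i, y ≤ x.lower i := by
  have hle : y.1 ≤ x.1 := h.le
  have hex : ∃ i, y.1 i < x.1 i := (Pi.lt_def.1 (Subtype.coe_lt_coe.2 h)).2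
  obtain ⟨i, hi, hmin⟩ := WellFounded.has_min (wellFounded_lt (α := Fin k))
    {i | y.1 i < x.1 i} hex
  have hi : y.1 i < x.1 i := hi
  have hbelow (j : Fin k) (hj : j < i) : x.1 j ≤ x.1 i - 1 := by
    have h1 : ¬ y.1 j < x.1 j := fun h => hmin j h hj
    have h2 := y.2 hj.le
    omega
  refine ⟨⟨i, by omega, fun a b hab => ?_⟩, ?_⟩
  · rcases eq_or_ne a i with rfl | ha <;> rcases eq_or_ne b a with rfl | hb
    · simp
    · have := x.2 hab
      simp only [Function.update_self, Function.update_of_ne hb]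
      omega
    · simp
    · rcases eq_or_ne b i with rfl | hb'
      · simpa [ha] using hbelow a (lt_of_le_of_ne hab ha)
      · simpa [ha, hb'] using x.2 hab
  · change y.1 ≤ Function.update x.1 i (x.1 i - 1)
    rw [le_update_iff]
    exact ⟨by omega, fun j _ => hle j⟩

theorem range_lower (x : MonotoneVec k) : Set.range x.lower = {y | y ⋖ x} := by
  ext y
  constructor
  · rintro ⟨i, rfl⟩
    exact x.lower_covBy i
  · intro (hy : y ⋖ x)
    obtain ⟨i, hi⟩ := exists_lower_of_lt hy.lt
    exact ⟨i, (hi.eq_or_lt.resolve_right fun h => hy.2 h (x.lower_covBy i).lt).symm⟩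

theorem lower_injective (x : MonotoneVec k) : Function.Injective x.lower := by
  intro i j h
  by_contra hij
  have h1 := congrFun (congrArg Subtype.val h) i.1
  have hne : i.1 ≠ j.1 := fun h => hij (Subtype.ext h)
  simp only [lower, Function.update_self, Function.update_of_ne hne] at h1
  have := i.2.1
  omega

theorem finite_Iic (x : MonotoneVec k) : (Set.Iic x).Finite :=
  Set.Finite.of_finite_image ((Set.finite_Iic x.1).subset (by rintro _ ⟨y, hy, rfl⟩; exact hy))
    Subtype.val_injective.injOn

open Classical in
theorem ncard_maxChainsBelow_eq_sum {x : MonotoneVec k} (hx : ¬ IsMin x) :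
    (maxChainsBelow x).ncard = ∑ i, (maxChainsBelow (x.lower i)).ncard := by
  rw [ncard_maxChainsBelow x.finite_Iic hx, ← range_lower, finsum_mem_range x.lower_injective,
    finsum_eq_sum_of_fintype]

/-- The strictly increasing vector `xᵢ + i`. -/
def shift (x : MonotoneVec k) (i : Fin k) : ℕ := x.1 i + i

theorem shift_lower (x : MonotoneVec k) (i : {i // x.IsRemovable i}) :
    (x.lower i).shift = Function.update x.shift i (x.shift i - 1) := by
  have := i.2.1
  ext j
  rcases eq_or_ne j i.1 with rfl | hj
  · simp only [shift, lower, Function.update_self]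
    omega
  · simp [shift, lower, hj]

theorem sum_lower (x : MonotoneVec k) (i : {i // x.IsRemovable i}) :
    ∑ j, x.1 j = ∑ j, (x.lower i).1 j + 1 := by
  have := i.2.1
  simp only [lower]
  rw [Finset.sum_update_of_mem (Finset.mem_univ _), ← Finset.add_sum_erase _ _
    (Finset.mem_univ i.1), Finset.sdiff_singleton_eq_erase]
  omega

theorem prod_factorial_shift_lower (x : MonotoneVec k) (i : {i // x.IsRemovable i}) :
    ∏ j, (x.shift j)! = x.shift i * ∏ j, ((x.lower i).shift j)! := by
  have h0 : x.shift i ≠ 0 := by have := i.2.1; simp only [shift]; omega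
  have h (j : Fin k) : ((x.lower i).shift j)!
      = Function.update (fun j => (x.shift j)!) i.1 (x.shift i - 1)! j := by
    rw [shift_lower]
    rcases eq_or_ne j i.1 with rfl | hj <;> simp [*]
  simp_rw [h]
  rw [Finset.prod_update_of_mem (Finset.mem_univ _), ← Finset.mul_prod_erase _ _
    (Finset.mem_univ i.1), Finset.sdiff_singleton_eq_erase, ← mul_assoc,
    Nat.mul_factorial_pred h0]

/-- Either `i` is the first index and `x i = 0`, so the factor vanishes, or `x (i - 1) = x i`, so
lowering the shifted entry creates two equal rows. Hence the sum over removable indices may run over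
all indices. -/
theorem mul_descFactorialDet_eq_zero {x : MonotoneVec k} {i : Fin k} (hi : ¬ x.IsRemovable i) :
    (x.shift i : ℤ) * descFactorialDet (Function.update x.shift i (x.shift i - 1)) = 0 := by
  rcases Nat.eq_zero_or_pos i.1 with hi0 | hi0
  · have h0 : x.1 i = 0 := by
      by_contra h
      refine hi ⟨by omega, fun a b hab => ?_⟩
      rcases eq_or_ne a i with rfl | ha
      · rcases eq_or_ne b a with rfl | hb
        · simp
        · have := x.2 hab
          simp only [Function.update_self, Function.update_of_ne hb]
          omega
      · have hb : b ≠ i := by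
          rintro rfl
          have : a.1 ≤ b.1 := hab
          exact ha (Fin.ext (by omega))
        simpa [ha, hb] using x.2 hab
    simp [shift, h0, hi0]
  · set j : Fin k := ⟨i.1 - 1, by omega⟩ with hj
    have hji : j < i := Fin.lt_def.2 (by simp only [hj]; omega)
    have heq : x.1 j = x.1 i := by
      refine le_antisymm (x.2 hji.le) ?_
      by_contra! h
      refine hi ⟨by omega, fun a b hab => ?_⟩
      rcases eq_or_ne a i with rfl | ha <;> rcases eq_or_ne b a with rfl | hb
      · simp
      · have := x.2 hab
        simp only [Function.update_self, Function.update_of_ne hb]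
        omega
      · simp
      · rcases eq_or_ne b i with rfl | hb'
        · have haj : a ≤ j := by
            have : a < b := lt_of_le_of_ne hab ha
            rw [Fin.lt_def] at this
            rw [Fin.le_def]
            simp only [hj]
            omega
          have := x.2 haj
          simp only [Function.update_self, Function.update_of_ne ha]
          omega
        · simpa [ha, hb'] using x.2 hab
    rw [descFactorialDet_eq_zero hji.ne, mul_zero]
    rw [Function.update_self, Function.update_of_ne hji.ne]
    have hji' : j.1 = i.1 - 1 := rfl
    simp only [shift, heq]
    omega

open Classical in
/-- The number of maximal chains below a weakly increasing vector (Frobenius' formula). -/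
theorem ncard_maxChainsBelow_mul_prod (x : MonotoneVec k) :
    ((maxChainsBelow x).ncard : ℤ) * ∏ i, ((x.shift i)! : ℤ)
      = ((∑ i, x.1 i)! : ℤ) * descFactorialDet x.shift := by
  induction hm : ∑ i, x.1 i generalizing x with
  | zero =>
    have hx0 (i : Fin k) : x.1 i = 0 := by simpa using Finset.sum_eq_zero_iff.1 hm i
    have hmin : IsMin x := fun y _ => by
      intro i
      change x.1 i ≤ y.1 i
      rw [hx0]
      exact Nat.zero_le _
    have hs : x.shift = fun i : Fin k => 0 + (i : ℕ) := funext fun i => by simp [shift, hx0]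
    rw [maxChainsBelow_of_isMin hmin, hs, descFactorialDet_add_val]
    simp [Fin.prod_univ_eq_prod_range (fun i => (i ! : ℤ))]
  | succ m ih =>
    have hmin : ¬ IsMin x := by
      intro h
      have h0 : (⟨fun _ => 0, fun _ _ _ => le_rfl⟩ : MonotoneVec k) ≤ x :=
        fun i => Nat.zero_le _
      have h1 (i : Fin k) : x.1 i = 0 := Nat.le_zero.1 (h h0 i)
      simp [h1] at hm
    have hterm (i : {i // x.IsRemovable i}) :
        ((maxChainsBelow (x.lower i)).ncard : ℤ) * ∏ i, ((x.shift i)! : ℤ)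
          = (m ! : ℤ) * ((x.shift i : ℤ)
            * descFactorialDet (Function.update x.shift i (x.shift i - 1))) := by
      have h := ih (x.lower i) (by have := x.sum_lower i; omega)
      have hp := congrArg (Nat.cast (R := ℤ)) (x.prod_factorial_shift_lower i)
      push_cast at hp
      rw [shift_lower] at h
      rw [hp, shift_lower, mul_left_comm, h]
      ring
    have hsum : ∑ i, ((x.shift i : ℤ) - (i : ℕ)) = ((m + 1 : ℕ) : ℤ) := by
      rw [← hm]
      simp [shift]
    rw [ncard_maxChainsBelow_eq_sum hmin, Nat.cast_sum, Finset.sum_mul]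
    simp_rw [hterm]
    -- Non-removable indices contribute zero, so the determinant identity applies to the full sum.
    rw [← Finset.mul_sum, ← Finset.sum_subtype (Finset.univ.filter x.IsRemovable) (by simp)
        fun i => (x.shift i : ℤ) * descFactorialDet (Function.update x.shift i (x.shift i - 1)),
      Finset.sum_filter_of_ne fun i _ h => not_imp_comm.1 mul_descFactorialDet_eq_zero h,
      sum_mul_descFactorialDet_update, hsum, Nat.factorial_succ]
    push_cast
    ring

end MonotoneVec

/-! ### Coordinates on the iterated lax sum -/

namespace StackedTrivial

/-- The coordinates of a point of `Σᵏₙ C₀`: the indices of the summands in which it lies. -/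
def coords : ∀ k n : ℕ, StackedTrivial k n → Fin k → ℕ
  | 0, _, _ => Fin.elim0
  | k + 1, _, a => Fin.snoc (α := fun _ => ℕ)
      (coords k (PosetSeq.LaxSum.idx a) (PosetSeq.LaxSum.val a)) (PosetSeq.LaxSum.idx a)

theorem coords_map (k n : ℕ) (a : StackedTrivial k n) :
    coords k (n + 1) ((trivialSeq.iterStack k).map n a) = coords k n a := by
  cases k <;> rfl

theorem coords_transition (k : ℕ) {m n : ℕ} (h : m ≤ n) (a : StackedTrivial k m) :
    coords k n ((trivialSeq.iterStack k).transition h a) = coords k m a := by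
  induction n, h using Nat.le_induction with
  | base => rw [PosetSeq.transition_self]
  | succ n h ih => rw [PosetSeq.transition_succ _ h, coords_map, ih]

theorem snoc_le_snoc {k : ℕ} {x y : Fin k → ℕ} {a b : ℕ} :
    (Fin.snoc (α := fun _ => ℕ) x a : Fin (k + 1) → ℕ) ≤ Fin.snoc (α := fun _ => ℕ) y b ↔
      a ≤ b ∧ x ≤ y := by
  simp [Pi.le_def, Fin.forall_fin_succ', and_comm]

/-- The indices compare the last coordinates; since transition maps preserve coordinates, the
remaining condition in the lax order compares the others, by induction. -/
theorem coords_le_coords (k n : ℕ) (a b : StackedTrivial k n) :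
    coords k n a ≤ coords k n b ↔ a ≤ b := by
  induction k generalizing n with
  | zero =>
    exact iff_of_true (fun i => i.elim0) (Subsingleton.elim (α := Fin 1) a b).le
  | succ k ih =>
    rw [coords, coords, snoc_le_snoc]
    change _ ↔ ∃ h : _, _ ≤ _
    rw [← exists_prop]
    refine exists_congr fun h => ?_
    rw [← ih, coords_transition]

theorem monotone_snoc {k : ℕ} {x : Fin k → ℕ} {a : ℕ} :
    Monotone (Fin.snoc (α := fun _ => ℕ) x a : Fin (k + 1) → ℕ) ↔
      Monotone x ∧ ∀ i, x i ≤ a := by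
  constructor
  · intro h
    refine ⟨fun i j hij => ?_, fun i => ?_⟩
    · simpa using h (Fin.castSucc_le_castSucc_iff.2 hij)
    · simpa using h (Fin.le_last i.castSucc)
  · rintro ⟨h1, h2⟩ i j hij
    induction j using Fin.lastCases with
    | last =>
      induction i using Fin.lastCases with
      | last => rfl
      | cast i => simpa using h2 i
    | cast j =>
      induction i using Fin.lastCases with
      | last => exact absurd (hij.trans_lt (Fin.castSucc_lt_last j)) (lt_irrefl _)
      | cast i => simpa using h1 (Fin.castSucc_le_castSucc_iff.1 hij)

/-- A point with last coordinate `j` has its other coordinates from `Σᵏⱼ C₀`, hence bounded by `j`;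
this bound is exactly what monotonicity adds. -/
theorem range_coords (k n : ℕ) :
    Set.range (coords k n) = {x | Monotone x ∧ ∀ i, x i ≤ n} := by
  induction k generalizing n with
  | zero =>
    refine Set.eq_of_subset_of_subset
      (fun x _ => ⟨fun i => i.elim0, fun i => i.elim0⟩) fun x _ => ⟨(0 : Fin 1), ?_⟩
    exact Subsingleton.elim _ _
  | succ k ih =>
    ext x
    constructor
    · rintro ⟨⟨j, hj, a⟩, rfl⟩
      have h : coords k j a ∈ {x | Monotone x ∧ ∀ i, x i ≤ j} := ih j ▸ ⟨a, rfl⟩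
      refine ⟨monotone_snoc.2 h, fun i => ?_⟩
      induction i using Fin.lastCases with
      | last => simpa [coords] using hj
      | cast i => simpa [coords] using (h.2 i).trans hj
    · rintro ⟨hx, hn⟩
      rw [← Fin.snoc_init_self x] at hx
      have h : (Fin.init x : Fin k → ℕ) ∈ Set.range (coords k (x (Fin.last k))) := by
        rw [ih]
        exact monotone_snoc.1 hx
      obtain ⟨a, ha⟩ := h
      refine ⟨⟨x (Fin.last k), hn _, a⟩, ?_⟩
      change Fin.snoc (α := fun _ => ℕ) (coords k (x (Fin.last k)) a) (x (Fin.last k)) = x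
      rw [ha]
      exact Fin.snoc_init_self x

theorem monotone_coords {k n : ℕ} (a : StackedTrivial k n) : Monotone (coords k n a) :=
  ((range_coords k n).subset ⟨a, rfl⟩).1

theorem coords_le {k n : ℕ} (a : StackedTrivial k n) (i : Fin k) : coords k n a i ≤ n :=
  ((range_coords k n).subset ⟨a, rfl⟩).2 i

/-- The poset `Σᵏₙ C₀` as a subposet of the weakly increasing vectors. -/
def toMonotoneVec (k n : ℕ) : StackedTrivial k n ↪o MonotoneVec k :=
  OrderEmbedding.ofMapLEIff (fun a => ⟨coords k n a, monotone_coords a⟩)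
    fun a b => coords_le_coords k n a b

theorem range_toMonotoneVec (k n : ℕ) :
    Set.range (toMonotoneVec k n) = Set.Iic ⟨fun _ => n, monotone_const⟩ := by
  ext x
  constructor
  · rintro ⟨a, rfl⟩
    exact fun i => coords_le a i
  · intro hx
    obtain ⟨a, ha⟩ := (range_coords k n).superset ⟨x.2, fun i => hx i⟩
    exact ⟨a, Subtype.ext ha⟩

/-- The coordinates of a point of `Σᵏₙ C₀`, as a point of the power `Cₙᵏ`. -/
def toChainPower (k n : ℕ) : StackedTrivial k n ↪o {x : Fin k → ChainPoset n // Monotone x} :=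
  OrderEmbedding.ofMapLEIff
    (fun a => ⟨fun i => ⟨coords k n a i, Nat.lt_succ_of_le (coords_le a i)⟩,
      fun _ _ h => monotone_coords a h⟩)
    fun a b => coords_le_coords k n a b

theorem toChainPower_surjective (k n : ℕ) : Function.Surjective (toChainPower k n) := by
  intro x
  obtain ⟨a, ha⟩ := (range_coords k n).superset
    (show (fun i => (x.1 i : ℕ)) ∈ _ from ⟨fun _ _ h => x.2 h, fun i => Nat.le_of_lt_succ (x.1 i).2⟩)
  exact ⟨a, Subtype.ext (funext fun i => Fin.ext (congrFun ha i))⟩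

end StackedTrivial

/-! ### The decreasing form and the count -/

/-- Reversing the coordinates turns increasing vectors into decreasing ones. -/
def monotoneOrderIsoAntitone (k : ℕ) (P : Type*) [Preorder P] :
    {x : Fin k → P // Monotone x} ≃o {x : Fin k → P // Antitone x} where
  toFun x := ⟨x.1 ∘ Fin.rev, x.2.comp_antitone Fin.rev_anti⟩
  invFun x := ⟨x.1 ∘ Fin.rev, x.2.comp Fin.rev_anti⟩
  left_inv x := Subtype.ext (by ext i; simp)
  right_inv x := Subtype.ext (by ext i; simp)
  map_rel_iff' {x y} := ⟨fun h i => by simpa using h i.rev, fun h i => h i.rev⟩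

theorem mainTheorem9 (k n : ℕ) :
    Nonempty (StackedTrivial k n ≃o {x : Fin k → ChainPoset n // Monotone x}) ∧
    Nonempty (StackedTrivial k n ≃o {x : Fin k → ChainPoset n // Antitone x}) ∧
    {s : Set (StackedTrivial k n) | IsMaxChain (· ≤ ·) s}.Finite ∧
    (numMaxChains (StackedTrivial k n) : ℚ) =
      ((∏ i ∈ Finset.range k, (i ! : ℚ)) * ((k * n)! : ℚ)) /
        ∏ i ∈ Finset.range k, ((n + i)! : ℚ) := by
  let e : StackedTrivial k n ≃o {x : Fin k → ChainPoset n // Monotone x} :=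
    RelIso.ofSurjective _ (StackedTrivial.toChainPower_surjective k n)
  have : Finite (StackedTrivial k n) := Finite.of_equiv _ e.symm.toEquiv
  refine ⟨⟨e⟩, ⟨e.trans (monotoneOrderIsoAntitone k _)⟩, Set.toFinite _, ?_⟩
  rw [numMaxChains_eq_ncard_maxChainsBelow _ (StackedTrivial.range_toMonotoneVec k n),
    eq_div_iff (Finset.prod_ne_zero_iff.2 fun i _ => Nat.cast_ne_zero.2 (Nat.factorial_ne_zero _))]
  -- Frobenius' formula at the top `(n, …, n)`, whose coordinate sum is `k * n`.
  have h := MonotoneVec.ncard_maxChainsBelow_mul_prod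
    (⟨fun _ => n, monotone_const⟩ : MonotoneVec k)
  have hs : MonotoneVec.shift (⟨fun _ => n, monotone_const⟩ : MonotoneVec k)
      = fun i : Fin k => n + i := rfl
  rw [hs, descFactorialDet_add_val,
    Fin.prod_univ_eq_prod_range (fun i => ((n + i)! : ℤ))] at h
  simp only [Finset.sum_const, Finset.card_univ, Fintype.card_fin, smul_eq_mul] at h
  rw [mul_comm (∏ i ∈ Finset.range k, (i ! : ℚ))]
  exact_mod_cast h
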